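/- Model. In the congested clique model, $n$ nodes communicate in synchronous rounds; in each round every node may send to every other node a (possibly different) message of $\lceil\log_2 n\rceil$ bits, and local computation is free. For integers $n,m,M\ge 1$ let $\mathrm{DIST}(n,m,M)$ be the following problem: given an $n\times m$ matrix $A$ and an $m\times n$ matrix $B$ with entries in $\{-M,\dots,M\}\cup\{\infty\}$, where node $\ell\in\{1,\dots,n\}$ initially has row $\ell$ of $A$ and column $\ell$ of $B$, compute the distance product $C=A*B$, $C[i,j]=\min_{1\le s\le m}(A[i,s]+B[s,j])$, so that at the end node $\ell$ has row $\ell$ and column $\ell$ of $C$. Its deterministic round complexity is the least number of rounds in which a deterministic algorithm solves every instance. Exponent. An algebraic algorithm of rank $t$ for the product of an $n\times m$ by an $m\times n$ matrix over a field $\mathbb F$ consists of coefficients $\alpha_{ij\mu},\beta_{ij\mu},\lambda_{ij\mu}\in\mathbb F$ with $(AB)[i,j]=\sum_{\mu=1}^t\lambda_{ij\mu}S^{(\mu)}T^{(\mu)}$ for all $A,B$ and all $i,j$, where $S^{(\mu)}=\sum_{i',j'}\alpha_{i'j'\mu}A[i',j']$ and $T^{(\mu)}=\sum_{i',j'}\beta_{i'j'\mu}B[j',i']$.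 Fix $q\in\mathbb N$. For $\gamma\ge 0$ let $\omega(\gamma)$ be the smallest $\tau$ such that for every $\varepsilon>0$ the product of an $n\times\lceil n^\gamma\rceil$ by an $\lceil n^\gamma\rceil\times n$ matrix has an algebraic algorithm of rank $O(n^{\tau+\varepsilon})$, uniformly over all finite fields of characteristic at least $q$ (for $q=0$: over all finite fields). Theorem. Let $\log$ be the logarithm to base 2. For all integers $1\le M\le n$ and $2\le m\le n$, the deterministic round complexity of $\mathrm{DIST}(n,m,M)$ is $$\begin{cases}O(M\log m)&\text{if } m\le\sqrt{Mn\log m},\\[2pt] O\big((M\log m)^{2/(\omega(\gamma)+\varepsilon)}\,n^{1-2/(\omega(\gamma)+\varepsilon)}\big)\ \text{for every fixed }\varepsilon>0&\text{if }\sqrt{Mn\log m}\le m\le n^2/(M\log m),\\[2pt] O(mM\log m/n)&\text{if } n^2/(M\log m)\le m\le n.\end{cases}$$ The constants in the first and third bound are absolute, and the one in the second bound depends only on $\varepsilon$ and $q$. In the second case $\gamma\ge0$ is the solution of $$\Big(1-\frac{\log M}{\log n}\Big)\gamma=1-\frac{\log M}{\log n}+\Big(\frac{\log m}{\log n}-1\Big)\omega(\gamma),$$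 which always exists in that range (the bound holds for every solution $\gamma\ge 0$). -/

import Mathlib

/-! ### The congested clique model -/

/-- A deterministic algorithm for the congested clique with `n` nodes: in every round each node sends
to each node a message of `b` bits, which depends on the sender, on its current local state and on
the addressee. Local computation is unrestricted. `I` is the type of local inputs and `O` the type
of local outputs. -/
structure CliqueAlgorithm (n b : ℕ) (I O : Type) where
  State : Type
  start : Fin n → I → State
  send : Fin n → State → Fin n → (Fin b → Bool)
  receive : Fin n → State → (Fin n → Fin b → Bool) → State
  output : Fin n → State → O

namespace CliqueAlgorithm

variable {n b : ℕ} {I O : Type}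

/-- The local state of each node after `t` synchronous rounds, on input `x`. -/
def stateAfter (P : CliqueAlgorithm n b I O) (x : Fin n → I) : ℕ → Fin n → P.State
  | 0, v => P.start v (x v)
  | t + 1, v =>
      P.receive v (P.stateAfter x t v) (fun u => P.send u (P.stateAfter x t u) v)

/-- The local output of each node after `t` rounds, on input `x`. -/
def outputAfter (P : CliqueAlgorithm n b I O) (x : Fin n → I) (t : ℕ) (v : Fin n) : O :=
  P.output v (P.stateAfter x t v)

end CliqueAlgorithm

/-! ### The distance product -/

/-- The distance (min-plus) product, `⊤` being the entry `∞`. -/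
def distProduct {n m : ℕ} (A : Matrix (Fin n) (Fin m) (WithTop ℤ))
    (B : Matrix (Fin m) (Fin n) (WithTop ℤ)) : Matrix (Fin n) (Fin n) (WithTop ℤ) :=
  fun i j => Finset.univ.inf (fun s : Fin m => A i s + B s j)

/-- All entries lie in `{-M, …, M} ∪ {∞}`. -/
def EntriesBounded {p r : ℕ} (M : ℕ) (A : Matrix (Fin p) (Fin r) (WithTop ℤ)) : Prop :=
  ∀ i j, A i j = ⊤ ∨ ∃ z : ℤ, A i j = (z : WithTop ℤ) ∧ |z| ≤ (M : ℤ)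

/-- The algorithm `P` computes within `T` rounds the distance product of every `n × m` matrix `A`
and every `m × n` matrix `B` with entries in `{-M, …, M} ∪ {∞}`: node `v` initially has row `v` of
`A` and column `v` of `B`, and finally has row `v` and column `v` of the product. -/
def ComputesDist (n m M b T : ℕ)
    (P : CliqueAlgorithm n b ((Fin m → WithTop ℤ) × (Fin m → WithTop ℤ))
      ((Fin n → WithTop ℤ) × (Fin n → WithTop ℤ))) : Prop :=
  ∀ (A : Matrix (Fin n) (Fin m) (WithTop ℤ)) (B : Matrix (Fin m) (Fin n) (WithTop ℤ)),
    EntriesBounded M A → EntriesBounded M B →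
    ∀ v : Fin n,
      P.outputAfter (fun u => (fun s => A u s, fun s => B s u)) T v =
        (fun j => distProduct A B v j, fun i => distProduct A B i v)

/-- The deterministic round complexity of the distance product problem for `(n, m, M)` in the
congested clique with messages of `⌈log₂ n⌉` bits is at most `R`. -/
def DistRoundsLE (n m M : ℕ) (R : ℝ) : Prop :=
  ∃ T : ℕ, (T : ℝ) ≤ R ∧ ∃ P, ComputesDist n m M (Nat.clog 2 n) T P

/-! ### Algebraic algorithms and the exponent of rectangular matrix multiplication -/

/-- There is an algebraic (bilinear) algorithm of rank `t` for the product of an `n × m` matrix by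
an `m × n` matrix over `F`. -/
def HasAlgebraicAlgorithm (F : Type) [Field F] (n m t : ℕ) : Prop :=
  ∃ (α β : Fin n → Fin m → Fin t → F) (lam : Fin n → Fin n → Fin t → F),
    ∀ (A : Matrix (Fin n) (Fin m) F) (B : Matrix (Fin m) (Fin n) F) (i j : Fin n),
      (A * B) i j = ∑ μ, lam i j μ *
        (∑ i', ∑ j', α i' j' μ * A i' j') * (∑ i', ∑ j', β i' j' μ * B j' i')

/-- For every `ε > 0`, the product of an `n × ⌈n ^ γ⌉` matrix by an `⌈n ^ γ⌉ × n` matrix can be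
computed by an algebraic algorithm of rank `O(n ^ (τ + ε))`, uniformly over all finite fields of
characteristic at least `q`. -/
def IsMMExponentBound (q : ℕ) (γ τ : ℝ) : Prop :=
  ∀ ε : ℝ, 0 < ε → ∃ K : ℝ, ∀ (F : Type) [Field F] [Finite F], q ≤ ringChar F →
    ∀ n : ℕ, 1 ≤ n → ∃ t : ℕ, (t : ℝ) ≤ K * (n : ℝ) ^ (τ + ε) ∧
      HasAlgebraicAlgorithm F n ⌈(n : ℝ) ^ γ⌉₊ t

/-- The exponent `ω(γ)` of rectangular matrix multiplication over the finite fields of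
characteristic at least `q` (all finite fields if `q = 0`). -/
noncomputable def mmExponent (q : ℕ) (γ : ℝ) : ℝ :=
  sInf {τ : ℝ | IsMMExponentBound q γ τ}

/-- `γ` is a (nonnegative) solution of the equation
`(1 - log M / log n) γ = 1 - log M / log n + (log m / log n - 1) ω(γ)`. -/
def IsBalancedExponent (q n m M : ℕ) (γ : ℝ) : Prop :=
  0 ≤ γ ∧
    (1 - Real.log M / Real.log n) * γ =
      1 - Real.log M / Real.log n + (Real.log m / Real.log n - 1) * mmExponent q γ

/-! Encode a finite entry `z` as `x ^ (z + M)` and `∞` as `0`. The product of the resulting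
polynomial matrices has degree at most `4M`, and its coefficient at `x ^ c` counts the indices `s`
with `A i s + B s j = c - 2M`. These counts are at most `m`, so the nonzero ones survive in
characteristic larger than `m`. Hence `4M + 1` matrix products over a field, one per evaluation
point, determine the distance product (`exists_dist_decoder`). For fixed `q` a prime field of size
`O(n)` suffices, so that a field element fits into `O(1)` messages.

For each point, an algebraic algorithm of rank `t` is applied to a division into `d × e` blocks, and
the `(4M + 1) t` block products are spread over the nodes (`exists_computesDist`). What a node owns
is not a block but positions within blocks: it knows these positions in all blocks and forms the
linear combinations locally. If `e ≤ d`, `d² ≤ n` and `M t = O(n)`, each node handles `O(1)` block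
products and the traffic takes `O(m / (d e) + n / d²)` rounds, up to rounding
(`distRoundsLE_of_block`). All message patterns are independent of the input, so an edge colouring
fixed in advance routes them (`Attains.route`).

It remains to choose `d` and `e`. For large `m`, `d = e = 1` is enough. For small `m`, take `e = 1`,
`t = d²` and `d ≈ √(n / M)`. In between, `d ≈ (n / M) ^ (1 / (ω(γ) + ε))` and `e ≈ d ^ γ`; the
equation for `γ` gives `m / e ≤ n / d`, so both traffic terms are `O(n / d²)`. As `γ` varies with
the instance, the rank constants must be uniform in `γ` (`exists_uniform_rank_bound`). A solution
`γ` exists by the intermediate value theorem, since `ω` is Lipschitz. -/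

/-! ### Composing congested clique algorithms -/

/-- On the inputs in `D`, the nodes can be brought into the local states `g x` within `T` rounds. -/
def Attains {n : ℕ} (b : ℕ) {I S : Type} (D : Set (Fin n → I)) (T : ℕ)
    (g : (Fin n → I) → Fin n → S) : Prop :=
  ∃ P : CliqueAlgorithm n b I S, ∀ x ∈ D, ∀ v, P.outputAfter x T v = g x v

namespace Attains

variable {n b : ℕ} {I S S' : Type} {D : Set (Fin n → I)} {T : ℕ} {g : (Fin n → I) → Fin n → S}

theorem start (D : Set (Fin n → I)) : Attains b D 0 (fun x v => x v) :=
  ⟨⟨I, fun _ i => i, fun _ _ _ _ => false, fun _ s _ => s, fun _ s => s⟩, fun _ _ _ => rfl⟩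

theorem map (hg : Attains b D T g) (h : Fin n → S → S') :
    Attains b D T (fun x v => h v (g x v)) := by
  obtain ⟨P, hP⟩ := hg
  refine ⟨⟨P.State, P.start, P.send, P.receive, fun v s => h v (P.output v s)⟩, fun x hx v => ?_⟩
  have key : ∀ t, CliqueAlgorithm.stateAfter
      ⟨P.State, P.start, P.send, P.receive, fun v s => h v (P.output v s)⟩ x t
        = P.stateAfter x t := by
    intro t
    induction t with
    | zero => rfl
    | succ t ih => funext v; simp only [CliqueAlgorithm.stateAfter, ih]
  simp only [CliqueAlgorithm.outputAfter, key]
  exact congrArg (h v) (hP x hx v)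

theorem congr {g' : (Fin n → I) → Fin n → S} (hg : Attains b D T g)
    (h : ∀ x ∈ D, ∀ v, g x v = g' x v) : Attains b D T g' := by
  obtain ⟨P, hP⟩ := hg
  exact ⟨P, fun x hx v => (hP x hx v).trans (h x hx v)⟩

theorem round (hg : Attains b D T g) (msg : Fin n → S → Fin n → Fin b → Bool)
    (h : Fin n → S → (Fin n → Fin b → Bool) → S') :
    Attains b D (T + 1) (fun x v => h v (g x v) (fun u => msg u (g x u) v)) := by
  obtain ⟨P, hP⟩ := hg
  -- The left summand runs `P` with a clock, which tells when the extra round is due; the right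
  -- summand keeps the result.
  let P' : CliqueAlgorithm n b I S' :=
    { State := (ℕ × P.State) ⊕ S'
      start := fun v i => Sum.inl (0, P.start v i)
      send := fun v s => Sum.elim
        (fun s => if s.1 < T then P.send v s.2 else msg v (P.output v s.2))
        (fun _ _ _ => false) s
      receive := fun v s w => Sum.elim
        (fun s => if s.1 < T then Sum.inl (s.1 + 1, P.receive v s.2 w)
          else Sum.inr (h v (P.output v s.2) w)) (fun s => Sum.inr s) s
      output := fun v s => Sum.elim (fun s => h v (P.output v s.2) (fun _ _ => false)) id s }
  refine ⟨P', fun x hx v => ?_⟩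
  have key : ∀ t ≤ T, ∀ v, P'.stateAfter x t v = Sum.inl (t, P.stateAfter x t v) := by
    intro t
    induction t with
    | zero => intro _ v; rfl
    | succ t ih =>
      intro ht v
      have h1 := ih (by omega)
      have h2 : t < T := by omega
      simp only [CliqueAlgorithm.stateAfter, h1]
      simp [P', h2]
  have h3 := key T le_rfl
  have h4 : ∀ v, P.output v (P.stateAfter x T v) = g x v := hP x hx
  simp only [CliqueAlgorithm.outputAfter, CliqueAlgorithm.stateAfter, h3]
  simp [P', h4]

/-- In `c` rounds every node can send a string of `c` words to every node. -/
theorem exchange_words (hg : Attains b D T g) (c : ℕ)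
    (msg : Fin n → S → Fin n → Fin c → Fin b → Bool) :
    Attains b D (T + c) (fun x v => (g x v, fun u => msg u (g x u) v)) := by
  induction c with
  | zero =>
    refine (hg.map (fun v s => (s, fun _ i => i.elim0))).congr fun x _ v => ?_
    refine Prod.ext rfl ?_
    funext u i
    exact i.elim0
  | succ c ih =>
    refine ((ih (fun u s v i => msg u s v i.castSucc)).round
      (fun u s v => msg u s.1 v (Fin.last c))
      (fun v s w => (s.1, fun u => Fin.snoc (α := fun _ => Fin b → Bool) (s.2 u) (w u)))).congr
      fun x _ v => ?_
    refine Prod.ext rfl ?_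
    funext u
    exact Fin.snoc_init_self (α := fun _ => Fin b → Bool) (msg u (g x u) v)

/-- In `c` rounds every node can send an element of a type with `2 ^ (b * c)` elements to every
node. -/
theorem exchange (hg : Attains b D T g) {W : Type} [Fintype W] [Nonempty W] {c : ℕ}
    (hW : Fintype.card W ≤ 2 ^ (b * c)) (msg : Fin n → S → Fin n → W) :
    Attains b D (T + c) (fun x v => (g x v, fun u => msg u (g x u) v)) := by
  have hcard : Fintype.card W ≤ Fintype.card (Fin c → Fin b → Bool) := by
    simpa [← pow_mul] using hW
  obtain ⟨enc⟩ := Function.Embedding.nonempty_of_card_le hcard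
  refine ((hg.exchange_words c (fun u s v => enc (msg u s v))).map
    (fun v s => (s.1, fun u => Function.invFun enc (s.2 u)))).congr fun x _ v => ?_
  refine Prod.ext rfl ?_
  funext u
  exact Function.leftInverse_invFun enc.injective _

open Classical in
/-- Messages `e : E`, at most one for every sender, addressee and slot, are delivered directly. -/
theorem deliver (hg : Attains b D T g) {E F J : Type} [Zero F] [Fintype F] [Fintype J] {c : ℕ}
    (hF : Fintype.card F ≤ 2 ^ (b * c)) (src dst : E → Fin n) (slot : E → J)
    (hinj : Function.Injective fun e => (src e, dst e, slot e)) (val : E → S → F) :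
    Attains b D (T + Fintype.card J * c)
      (fun x v => (g x v, fun e => if dst e = v then val e (g x (src e)) else 0)) := by
  have hW : Fintype.card (J → F) ≤ 2 ^ (b * (Fintype.card J * c)) := by
    rw [Fintype.card_fun]
    calc _ ≤ (2 ^ (b * c)) ^ Fintype.card J := Nat.pow_le_pow_left hF _
      _ = _ := by rw [← pow_mul]; ring_nf
  refine ((hg.exchange hW (fun u s v r =>
    if h : ∃ e, src e = u ∧ dst e = v ∧ slot e = r then val h.choose s else 0)).map
    (fun v s => (s.1, fun e => if dst e = v then s.2 (src e) (slot e) else 0))).congr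
    fun x _ v => ?_
  refine Prod.ext rfl ?_
  funext e
  by_cases hv : dst e = v
  · have h : ∃ e', src e' = src e ∧ dst e' = v ∧ slot e' = slot e := ⟨e, rfl, hv, rfl⟩
    have he : h.choose = e := by
      obtain ⟨h1, h2, h3⟩ := h.choose_spec
      exact hinj (by simp [h1, h2, h3, hv])
    simp only [hv, if_true, dif_pos h, he]
  · simp [hv]

end Attains

/-! ### Routing by edge colouring -/

/-- Greedy edge colouring of a bipartite multigraph of maximum degree `Δ` with `2 * Δ` colours. -/
theorem exists_edge_coloring {E V W K : Type} [Fintype E] [Fintype K] [Nonempty K]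
    [DecidableEq V] [DecidableEq W]
    (src : E → V) (dst : E → W) {Δ : ℕ} (hK : 2 * Δ ≤ Fintype.card K)
    (hs : ∀ u, (Finset.univ.filter fun e => src e = u).card ≤ Δ)
    (hd : ∀ u, (Finset.univ.filter fun e => dst e = u).card ≤ Δ) :
    ∃ col : E → K, ∀ e e', e ≠ e' → col e = col e' → src e ≠ src e' ∧ dst e ≠ dst e' := by
  classical
  have key : ∀ s : Finset E, ∃ col : E → K, ∀ e ∈ s, ∀ e' ∈ s, e ≠ e' → col e = col e' →
      src e ≠ src e' ∧ dst e ≠ dst e' := by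
    intro s
    induction s using Finset.induction_on with
    | empty => exact ⟨fun _ => Classical.arbitrary K, by simp⟩
    | insert a s ha ih =>
      obtain ⟨col, hcol⟩ := ih
      -- The edge `a` itself uses up one unit of the degree, so at most `2 * (Δ - 1)` colours are
      -- forbidden for it.
      have h1 : (s.filter fun e => src e = src a).card + 1 ≤ Δ := by
        refine le_trans ?_ (hs (src a))
        rw [← Finset.card_insert_of_notMem (a := a) (by simp [ha])]
        exact Finset.card_le_card (by intro e; simp; grind)
      have h2 : (s.filter fun e => dst e = dst a).card + 1 ≤ Δ := by
        refine le_trans ?_ (hd (dst a))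
        rw [← Finset.card_insert_of_notMem (a := a) (by simp [ha])]
        exact Finset.card_le_card (by intro e; simp; grind)
      let bad := ((s.filter fun e => src e = src a) ∪ (s.filter fun e => dst e = dst a)).image col
      have hbad : bad.card < Fintype.card K := by
        have := Finset.card_image_le (f := col)
          (s := (s.filter fun e => src e = src a) ∪ (s.filter fun e => dst e = dst a))
        have h4 := Finset.card_union_le (s.filter fun e => src e = src a)
          (s.filter fun e => dst e = dst a)
        simp only [bad]
        omega
      obtain ⟨κ, hκ⟩ : ∃ κ, κ ∉ bad := by
        by_contra! hall
        exact hbad.ne ((Finset.card_eq_iff_eq_univ bad).2 (Finset.eq_univ_iff_forall.2 hall))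
      have hκ' : ∀ e ∈ s, col e = κ → src e ≠ src a ∧ dst e ≠ dst a := by
        intro e he hc
        constructor <;> intro hh <;> apply hκ <;>
          exact Finset.mem_image.2 ⟨e, by simp [he, hh], hc⟩
      refine ⟨Function.update col a κ, fun e he e' he' hne hc => ?_⟩
      rcases Finset.mem_insert.1 he with rfl | hes
      · rcases Finset.mem_insert.1 he' with rfl | hes'
        · exact absurd rfl hne
        · rw [Function.update_self, Function.update_of_ne hne.symm] at hc
          exact ⟨(hκ' e' hes' hc.symm).1.symm, (hκ' e' hes' hc.symm).2.symm⟩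
      · rcases Finset.mem_insert.1 he' with rfl | hes'
        · rw [Function.update_self, Function.update_of_ne hne] at hc
          exact hκ' e hes hc
        · have n1 : e ≠ a := by rintro rfl; exact ha hes
          have n2 : e' ≠ a := by rintro rfl; exact ha hes'
          rw [Function.update_of_ne n1, Function.update_of_ne n2] at hc
          exact hcol e hes e' hes' hne hc
  obtain ⟨col, hcol⟩ := key Finset.univ
  exact ⟨col, fun e e' => hcol e (Finset.mem_univ _) e' (Finset.mem_univ _)⟩

/-- A family of messages whose pattern does not depend on the input, such that every node sends
and receives at most `n * L` messages, can be routed through intermediate nodes. -/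
theorem Attains.route {n b : ℕ} {I S : Type} {D : Set (Fin n → I)} {T : ℕ}
    {g : (Fin n → I) → Fin n → S} (hg : Attains b D T g) {E F : Type} [Fintype E] [Zero F]
    [Fintype F] {c L : ℕ} (hn : 0 < n) (hL : 0 < L)
    (hF : Fintype.card F ≤ 2 ^ (b * c)) (src dst : E → Fin n)
    (hs : ∀ u, (Finset.univ.filter fun e => src e = u).card ≤ n * L)
    (hd : ∀ u, (Finset.univ.filter fun e => dst e = u).card ≤ n * L) (val : E → S → F) :
    Attains b D (T + 4 * L * c)
      (fun x v => (g x v, fun e => if dst e = v then val e (g x (src e)) else 0)) := by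
  have : Nonempty (Fin n × Fin (2 * L)) := ⟨(⟨0, hn⟩, ⟨0, by omega⟩)⟩
  -- A colour is a relay node together with a slot. Properness at the sources makes the hop to the
  -- relay collision-free, properness at the targets the hop from it.
  obtain ⟨col, hcol⟩ := exists_edge_coloring (K := Fin n × Fin (2 * L)) src dst
    (Δ := n * L) (by simp; nlinarith) hs hd
  have h1 := hg.deliver hF src (fun e => (col e).1) (fun e => (col e).2) (by
    intro e e' h
    simp only [Prod.mk.injEq] at h
    by_contra hne
    exact (hcol e e' hne (Prod.ext h.2.1 h.2.2)).1 h.1) val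
  have h2 := h1.deliver hF (fun e => (col e).1) dst (fun e => (col e).2) (by
    intro e e' h
    simp only [Prod.mk.injEq] at h
    by_contra hne
    exact (hcol e e' hne (Prod.ext h.1 h.2.2)).2 h.2.1) (fun e s => s.2 e)
  have h3 := h2.map (fun v s => (s.1.1, s.2))
  have hT : T + Fintype.card (Fin (2 * L)) * c + Fintype.card (Fin (2 * L)) * c
      = T + 4 * L * c := by simp; ring
  rw [hT] at h3
  refine h3.congr fun x _ v => ?_
  refine Prod.ext rfl ?_
  funext e
  simp

/-! ### Distance products over a finite field -/

/-- The entry `z` as the power `x ^ (z + M)`, the entry `∞` as `0`. -/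
def expEntry {R : Type} [CommSemiring R] (M : ℕ) (x : R) (z : WithTop ℤ) : R :=
  WithTop.recTopCoe (C := fun _ => R) 0 (fun z : ℤ => x ^ (z + M).toNat) z

/-- The value is `∞` or of absolute value at most `M`. -/
def BoundedEntry (M : ℕ) (a : WithTop ℤ) : Prop :=
  a = ⊤ ∨ ∃ z : ℤ, a = (z : WithTop ℤ) ∧ |z| ≤ (M : ℤ)

-- Each factor is zero or a monomial with exponent shifted by `M`, which accounts for the shift `2 *
-- M`.
open Polynomial in
theorem coeff_expEntry_mul {F : Type} [Field F] {M : ℕ} {a b : WithTop ℤ} (ha : BoundedEntry M a)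
    (hb : BoundedEntry M b) (c : ℕ) :
    (expEntry M (X : F[X]) a * expEntry M (X : F[X]) b).coeff c =
      if a + b = ((c - 2 * M : ℤ) : WithTop ℤ) then 1 else 0 := by
  rcases ha with rfl | ⟨z, rfl, hz⟩
  · rw [top_add, if_neg WithTop.top_ne_coe]
    simp [expEntry]
  rcases hb with rfl | ⟨w, rfl, hw⟩
  · rw [add_top, if_neg WithTop.top_ne_coe]
    simp [expEntry]
  simp only [expEntry, WithTop.recTopCoe_coe, ← pow_add, coeff_X_pow, ← WithTop.coe_add,
    WithTop.coe_inj]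
  rw [abs_le] at hz hw
  congr 1
  apply propext
  omega

theorem BoundedEntry.add {M : ℕ} {a b : WithTop ℤ} (ha : BoundedEntry M a)
    (hb : BoundedEntry M b) : BoundedEntry (2 * M) (a + b) := by
  rcases ha with rfl | ⟨z, rfl, hz⟩
  · exact Or.inl (by simp)
  rcases hb with rfl | ⟨w, rfl, hw⟩
  · exact Or.inl (by simp)
  refine Or.inr ⟨z + w, by simp, ?_⟩
  rw [abs_le] at *
  push_cast
  omega

theorem BoundedEntry.inf {M m : ℕ} {a : Fin m → WithTop ℤ} (ha : ∀ s, BoundedEntry M (a s)) :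
    BoundedEntry M (Finset.univ.inf a) := by
  refine Finset.inf_induction (Or.inl rfl) ?_ (fun s _ => ha s)
  intro x hx y hy
  rcases le_total x y with h | h
  · rwa [inf_eq_left.2 h]
  · rwa [inf_eq_right.2 h]

open Polynomial in
/-- The distance product can be read off from the evaluations at `4 * M + 1` points. -/
theorem exists_dist_decoder {F : Type} [Field F] {m M : ℕ}
    (hm : ∀ c : ℕ, 1 ≤ c → c ≤ m → (c : F) ≠ 0) (pt : Fin (4 * M + 1) → F)
    (hpt : Function.Injective pt) :
    ∃ dec : (Fin (4 * M + 1) → F) → WithTop ℤ, ∀ a b : Fin m → WithTop ℤ,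
      (∀ s, BoundedEntry M (a s)) → (∀ s, BoundedEntry M (b s)) →
      dec (fun κ => ∑ s, expEntry M (pt κ) (a s) * expEntry M (pt κ) (b s)) =
        Finset.univ.inf (fun s => a s + b s) := by
  classical
  -- Interpolate, then return the least `c - 2 * M` whose coefficient does not vanish.
  refine ⟨fun r => (Finset.range (4 * M + 1)).inf fun c =>
    if (Lagrange.interpolate Finset.univ pt r).coeff c = 0 then ⊤
      else ((c - 2 * M : ℤ) : WithTop ℤ), fun a b ha hb => ?_⟩
  let p : F[X] := ∑ s, expEntry M (X : F[X]) (a s) * expEntry M (X : F[X]) (b s)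
  have hcoeff : ∀ c, p.coeff c =
      ((Finset.univ.filter fun s => a s + b s = ((c - 2 * M : ℤ) : WithTop ℤ)).card : F) := by
    intro c
    simp only [p, finsetSum_coeff, coeff_expEntry_mul (ha _) (hb _)]
    simp
  have hzero : ∀ c, p.coeff c = 0 ↔ ∀ s, a s + b s ≠ ((c - 2 * M : ℤ) : WithTop ℤ) := by
    intro c
    rw [hcoeff]
    constructor
    · intro h s hs
      refine hm _ ?_ ?_ h
      · exact Finset.card_pos.2 ⟨s, by simp [hs]⟩
      · exact (Finset.card_le_univ _).trans (by simp)
    · intro h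
      rw [Finset.filter_false_of_mem (fun s _ => h s)]
      simp
  have heval : ∀ (x : F) (z : WithTop ℤ), eval x (expEntry M (X : F[X]) z) = expEntry M x z := by
    intro x z
    cases z using WithTop.recTopCoe <;> simp [expEntry]
  have hdeg : p.degree < (Finset.univ : Finset (Fin (4 * M + 1))).card := by
    rw [Finset.card_univ, Fintype.card_fin, degree_lt_iff_coeff_zero]
    intro c hc
    rw [hzero]
    intro s hs
    rcases (ha s).add (hb s) with h | ⟨z, h, hz⟩
    · exact WithTop.top_ne_coe (h.symm.trans hs)
    · rw [h, WithTop.coe_inj] at hs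
      rw [abs_le] at hz
      push_cast at hz
      omega
  have hp : Lagrange.interpolate Finset.univ pt
      (fun κ => ∑ s, expEntry M (pt κ) (a s) * expEntry M (pt κ) (b s)) = p := by
    rw [Lagrange.eq_interpolate hpt.injOn hdeg]
    congr 1
    funext κ
    simp [p, eval_finsetSum, heval]
  beta_reduce
  rw [hp]
  apply le_antisymm
  · refine Finset.le_inf fun s _ => ?_
    rcases (ha s).add (hb s) with h | ⟨z, h, hz⟩
    · rw [h]; exact le_top
    · rw [abs_le] at hz
      push_cast at hz
      have hz' : ((((z + 2 * M).toNat : ℕ) - 2 * M : ℤ)) = z := by omega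
      refine (Finset.inf_le (b := (z + 2 * M).toNat) (Finset.mem_range.2 (by omega))).trans ?_
      rw [if_neg, hz', h]
      rw [hzero]
      push Not
      exact ⟨s, by rw [hz', h]⟩
  · refine Finset.le_inf fun c _ => ?_
    split_ifs with h
    · exact le_top
    · rw [hzero] at h
      push Not at h
      obtain ⟨s, hs⟩ := h
      rw [← hs]
      exact Finset.inf_le (Finset.mem_univ s)

/-- Bounded entries can be stored in a field with `2 * M + 2` elements. -/
theorem exists_entry_code {F : Type} [Fintype F] [Nonempty F] {M : ℕ}
    (h : 2 * M + 2 ≤ Fintype.card F) :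
    ∃ (enc : WithTop ℤ → F) (dec : F → WithTop ℤ), ∀ z, BoundedEntry M z → dec (enc z) = z := by
  classical
  obtain ⟨ι⟩ : Nonempty (Fin (2 * M + 2) ↪ F) :=
    Function.Embedding.nonempty_of_card_le (by simpa using h)
  -- Index `0` is reserved for `∞`; finite values occupy the indices `1, …, 2 * M + 1`.
  let enc : WithTop ℤ → F := fun z =>
    WithTop.recTopCoe (C := fun _ => F) (ι (Fin.ofNat _ 0))
      (fun z : ℤ => ι (Fin.ofNat _ (z + M + 1).toNat)) z
  have hinj : Set.InjOn enc {z | BoundedEntry M z} := by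
    have hval : ∀ z : ℤ, |z| ≤ M → ((z + M + 1).toNat) % (2 * M + 2) = (z + M + 1).toNat := by
      intro z hz
      rw [abs_le] at hz
      exact Nat.mod_eq_of_lt (by omega)
    intro z hz w hw hzw
    rcases hz with rfl | ⟨z, rfl, hz⟩ <;> rcases hw with rfl | ⟨w, rfl, hw⟩
    · rfl
    · have := Fin.ext_iff.1 (ι.injective hzw)
      simp only [Fin.ofNat, hval w hw] at this
      rw [abs_le] at hw
      simp at this
      omega
    · have := Fin.ext_iff.1 (ι.injective hzw)
      simp only [Fin.ofNat, hval z hz] at this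
      rw [abs_le] at hz
      simp at this
      omega
    · have := Fin.ext_iff.1 (ι.injective hzw)
      simp only [Fin.ofNat, hval z hz, hval w hw] at this
      rw [abs_le] at hz hw
      congr 1
      omega
  exact ⟨enc, Function.invFunOn enc {z | BoundedEntry M z}, fun z hz => hinj.leftInvOn_invFunOn hz⟩

/-! ### Block matrix multiplication -/

/-- The entry `(x, y)` of the `μ`-th linear combination of the blocks of `X`, where `f` and `h`
assign to a row and to a column its block and its position in the block. -/
def blockCombination {F : Type} [Field F] {n m d e n₁ m₁ t : ℕ} (f : Fin n → Fin d × Fin n₁)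
    (h : Fin m → Fin e × Fin m₁) (coef : Fin d → Fin e → Fin t → F) (X : Fin n → Fin m → F)
    (μ : Fin t) (x : Fin n₁) (y : Fin m₁) : F :=
  ∑ i, ∑ s, if (f i).2 = x ∧ (h s).2 = y then coef (f i).1 (h s).1 μ * X i s else 0

/-- Relates the sum over entries, which the owner of a position evaluates, to a linear combination
over blocks, in the shape of an algebraic algorithm. Positions that hold no entry count as zero. -/
theorem blockCombination_eq {F : Type} [Field F] {n m d e n₁ m₁ t : ℕ} (f : Fin n → Fin d × Fin n₁)
    (h : Fin m → Fin e × Fin m₁) (coef : Fin d → Fin e → Fin t → F) (X : Fin n → Fin m → F)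
    (μ : Fin t) (x : Fin n₁) (y : Fin m₁) :
    blockCombination f h coef X μ x y = ∑ i', ∑ j', coef i' j' μ *
      ∑ i, ∑ s, if f i = (i', x) ∧ h s = (j', y) then X i s else 0 := by
  simp only [blockCombination, Finset.mul_sum]
  symm
  calc _ = ∑ i', ∑ i, ∑ s, ∑ j', coef i' j' μ *
        (if f i = (i', x) ∧ h s = (j', y) then X i s else 0) := by
        refine Finset.sum_congr rfl fun i' _ => ?_
        rw [Finset.sum_comm]
        exact Finset.sum_congr rfl fun i _ => Finset.sum_comm
    _ = ∑ i, ∑ s, ∑ i', ∑ j', coef i' j' μ *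
        (if f i = (i', x) ∧ h s = (j', y) then X i s else 0) := by
        rw [Finset.sum_comm]
        exact Finset.sum_congr rfl fun i _ => Finset.sum_comm
    _ = _ := by
        refine Finset.sum_congr rfl fun i _ => Finset.sum_congr rfl fun s _ => ?_
        rw [Finset.sum_eq_single (f i).1, Finset.sum_eq_single (h s).1]
        · by_cases h1 : (f i).2 = x <;> by_cases h2 : (h s).2 = y <;>
            simp [Prod.ext_iff, h1, h2]
        · intro j' _ hj
          rw [if_neg, mul_zero]
          rintro ⟨-, h2⟩
          exact hj (by rw [h2])
        · simp
        · intro i' _ hi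
          refine Finset.sum_eq_zero fun j' _ => ?_
          rw [if_neg, mul_zero]
          rintro ⟨h2, -⟩
          exact hi (by rw [h2])
        · simp

/-- Fixing the positions inside the blocks leaves `d × e` matrices over `F`, to which the algorithm
applies; summing over the inner position `y` recovers the full product. `Y` is the transposed right
factor, and injectivity of `f` and `h` permits incomplete blocks. -/
theorem sum_mul_eq_block {F : Type} [Field F] {n m d e n₁ m₁ t : ℕ} {f : Fin n → Fin d × Fin n₁}
    {h : Fin m → Fin e × Fin m₁} (hf : Function.Injective f) (hh : Function.Injective h)
    {α β : Fin d → Fin e → Fin t → F} {lam : Fin d → Fin d → Fin t → F}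
    (halg : ∀ (A : Matrix (Fin d) (Fin e) F) (B : Matrix (Fin e) (Fin d) F) (i j : Fin d),
      (A * B) i j = ∑ μ, lam i j μ *
        (∑ i', ∑ j', α i' j' μ * A i' j') * (∑ i', ∑ j', β i' j' μ * B j' i'))
    (X Y : Fin n → Fin m → F) (i j : Fin n) :
    ∑ s, X i s * Y j s = ∑ μ, lam (f i).1 (f j).1 μ *
      ∑ y, blockCombination f h α X μ (f i).2 y * blockCombination f h β Y μ (f j).2 y := by
  let U (Z : Fin n → Fin m → F) (x : Fin n₁) (y : Fin m₁) : Matrix (Fin d) (Fin e) F := fun i' j' =>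
    ∑ i, ∑ s, if f i = (i', x) ∧ h s = (j', y) then Z i s else 0
  have hU : ∀ Z y j' (i : Fin n), U Z (f i).2 y (f i).1 j' =
      ∑ s, if h s = (j', y) then Z i s else 0 := by
    intro Z y j' i
    simp only [U]
    rw [Finset.sum_eq_single i]
    · simp
    · intro i₁ _ hi
      refine Finset.sum_eq_zero fun s _ => ?_
      rw [if_neg]
      rintro ⟨h1, -⟩
      exact hi (hf h1)
    · simp
  symm
  calc _ = ∑ y, ∑ μ, lam (f i).1 (f j).1 μ *
        blockCombination f h α X μ (f i).2 y * blockCombination f h β Y μ (f j).2 y := by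
        rw [Finset.sum_comm]
        refine Finset.sum_congr rfl fun μ _ => ?_
        rw [Finset.mul_sum]
        exact Finset.sum_congr rfl fun y _ => by ring
    _ = ∑ y, (U X (f i).2 y * (U Y (f j).2 y).transpose) (f i).1 (f j).1 := by
        refine Finset.sum_congr rfl fun y _ => ?_
        rw [halg]
        refine Finset.sum_congr rfl fun μ _ => ?_
        rw [blockCombination_eq, blockCombination_eq]
        rfl
    _ = ∑ y, ∑ j', (∑ s, if h s = (j', y) then X i s else 0) *
          (∑ s, if h s = (j', y) then Y j s else 0) := by
        refine Finset.sum_congr rfl fun y _ => ?_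
        rw [Matrix.mul_apply]
        refine Finset.sum_congr rfl fun j' _ => ?_
        rw [Matrix.transpose_apply, hU, hU]
    _ = ∑ p : Fin e × Fin m₁, ∑ s, if h s = p then X i s * Y j s else 0 := by
        rw [Fintype.sum_prod_type_right]
        refine Finset.sum_congr rfl fun y _ => Finset.sum_congr rfl fun j' _ => ?_
        by_cases hex : ∃ s, h s = (j', y)
        · obtain ⟨s, hs⟩ := hex
          have : ∀ Z : Fin m → F, (∑ s', if h s' = (j', y) then Z s' else 0) = Z s := by
            intro Z
            rw [Finset.sum_eq_single s]
            · simp [hs]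
            · intro s' _ hne
              rw [if_neg]
              rw [← hs]
              exact fun h' => hne (hh h')
            · simp
          rw [this, this, this fun s => X i s * Y j s]
        · push Not at hex
          simp [hex]
    _ = _ := by
        rw [Finset.sum_comm]
        simp

/-! ### The distance product in the congested clique -/

theorem card_fiber_le_of_injective {E V J : Type} [Fintype E] [Fintype J] [DecidableEq V]
    (src : E → V) (slot : E → J) (hinj : Function.Injective fun e => (src e, slot e)) (u : V) :
    (Finset.univ.filter fun e => src e = u).card ≤ Fintype.card J := by
  refine Finset.card_le_card_of_injOn slot (fun _ _ => Finset.mem_univ _) ?_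
  intro e he e' he' h
  simp only [Finset.coe_filter, Finset.mem_univ, true_and, Set.mem_ofPred_eq] at he he'
  exact hinj (by simp [he, he', h])

theorem exists_injective_of_mul_le {J : Type} [Fintype J] {p q : ℕ}
    (h : Fintype.card J ≤ p * q) : ∃ f : J → Fin p × Fin q, Function.Injective f := by
  obtain ⟨f⟩ := Function.Embedding.nonempty_of_card_le
    (show Fintype.card J ≤ Fintype.card (Fin p × Fin q) by simpa using h)
  exact ⟨f, f.injective⟩

/-- The distance product by fast multiplication of block matrices over a finite field: the matrices
are divided into `d × e` blocks of format `n₁ × m₁`, `P` bounds the number of block positions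
and `Q` the number of block products handled by one node. -/
theorem exists_computesDist {n m M b c d e t n₁ m₁ P Q L : ℕ} {F : Type} [Field F] [Fintype F]
    (hn : 0 < n) (hL : 0 < L) (hmn : m ≤ n) (hF : Fintype.card F ≤ 2 ^ (b * c))
    (hFM : 4 * M + 2 ≤ Fintype.card F) (hchar : ∀ c : ℕ, 1 ≤ c → c ≤ m → (c : F) ≠ 0)
    (halg : HasAlgebraicAlgorithm F d e t)
    (hn₁ : n ≤ d * n₁) (hm₁ : m ≤ e * m₁) (hP₁ : n₁ * m₁ ≤ n * P) (hP₂ : n₁ * n₁ ≤ n * P)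
    (hQ : (4 * M + 1) * t ≤ n * Q) (hL₁ : P * (d * e) ≤ n * L) (hL₂ : P * (d * d) ≤ n * L) :
    ∃ A, ComputesDist n m M b (c * (16 * L + 3 * (P * Q))) A := by
  classical
  obtain ⟨α, β, lam, halg⟩ := halg
  obtain ⟨f, hf⟩ := exists_injective_of_mul_le (J := Fin n) (by simpa using hn₁)
  obtain ⟨h, hh⟩ := exists_injective_of_mul_le (J := Fin m) (by simpa using hm₁)
  obtain ⟨own, hown⟩ := exists_injective_of_mul_le (J := Fin n₁ × Fin m₁) (by simpa using hP₁)
  obtain ⟨out, hout⟩ := exists_injective_of_mul_le (J := Fin n₁ × Fin n₁) (by simpa using hP₂)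
  obtain ⟨work, hwork⟩ := exists_injective_of_mul_le (J := Fin (4 * M + 1) × Fin t)
    (by simpa using hQ)
  obtain ⟨pt⟩ : Nonempty (Fin (4 * M + 1) ↪ F) :=
    Function.Embedding.nonempty_of_card_le (by simp; omega)
  -- One code with bound `2 * M` serves both for the inputs and for the entries of the distance
  -- product.
  obtain ⟨enc, dec, hdec⟩ := exists_entry_code (F := F) (M := 2 * M) (by omega)
  obtain ⟨decode, hdecode⟩ := exists_dist_decoder hchar pt pt.injective
  have hmono : ∀ z, BoundedEntry M z → BoundedEntry (2 * M) z := by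
    rintro z (hz | ⟨w, hw, hz⟩)
    · exact Or.inl hz
    · exact Or.inr ⟨w, hw, hz.trans (by push_cast; omega)⟩
  let Inp := (Fin m → WithTop ℤ) × (Fin m → WithTop ℤ)
  -- `true` selects the row of `A`, `false` the column of `B`, so both matrices are handled by node
  -- index.
  let side : Bool → Inp → Fin m → WithTop ℤ := fun σ x => if σ then x.1 else x.2
  let coef : Bool → Fin d → Fin e → Fin t → F := fun σ => if σ then α else β
  let D : Set (Fin n → Inp) := {x | ∀ σ i s, BoundedEntry M (side σ (x i) s)}
  -- block positions are collected by their owners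
  have s₁ := (Attains.start (b := b) D).route (E := Bool × Fin n × Fin m) (L := 2 * L) hn (by omega)
    hF (fun e => e.2.1) (fun e => (own ((f e.2.1).2, (h e.2.2).2)).1)
    (fun u => (card_fiber_le_of_injective _ (fun e => (e.1, e.2.2))
      (by rintro ⟨σ, i, s⟩ ⟨σ', i', s'⟩ h; simp at h ⊢; tauto) u).trans (by simp; nlinarith))
    (fun u => (card_fiber_le_of_injective _
      (fun e => (e.1, (own ((f e.2.1).2, (h e.2.2).2)).2, (f e.2.1).1, (h e.2.2).1))
      (by
        rintro ⟨σ, i, s⟩ ⟨σ', i', s'⟩ hE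
        simp only [Prod.mk.injEq] at hE ⊢
        obtain ⟨h1, h2, h3, h4, h5⟩ := hE
        have h6 := hown (Prod.ext h1 h3)
        simp only [Prod.mk.injEq] at h6
        exact ⟨h2, hf (Prod.ext h4 h6.1), hh (Prod.ext h5 h6.2)⟩) u).trans
      (by simp; nlinarith))
    (fun e x => enc (side e.1 x e.2.2))
  -- the owners send the linear combinations of the blocks to the multiplying nodes
  let comb (x : Fin n → Inp) (e : Bool × (Fin n₁ × Fin m₁) × (Fin (4 * M + 1) × Fin t)) : F :=
    blockCombination f h (coef e.1)
      (fun i s => expEntry M (pt e.2.2.1) (side e.1 (x i) s)) e.2.2.2 e.2.1.1 e.2.1.2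
  have s₂ := ((s₁.deliver (E := Bool × (Fin n₁ × Fin m₁) × (Fin (4 * M + 1) × Fin t))
    hF (fun e => (own e.2.1).1) (fun e => (work e.2.2).1)
    (fun e => (e.1, (own e.2.1).2, (work e.2.2).2)) (by
      rintro ⟨σ, p, w⟩ ⟨σ', p', w'⟩ hE
      simp only [Prod.mk.injEq] at hE ⊢
      obtain ⟨h1, h2, h3, h4, h5⟩ := hE
      exact ⟨h3, hown (Prod.ext h1 h4), hwork (Prod.ext h2 h5)⟩)
    (fun e st => blockCombination f h (coef e.1)
      (fun i s => expEntry M (pt e.2.2.1) (dec (st.2 (e.1, i, s)))) e.2.2.2 e.2.1.1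
        e.2.1.2)).map (fun v st => st.2)).congr
    (g' := fun x v e => if (work e.2.2).1 = v then comb x e else 0) (by
      intro x hx v
      funext e
      dsimp only
      split_ifs with hv
      · refine Finset.sum_congr rfl fun i _ => Finset.sum_congr rfl fun s _ => ?_
        -- The sender owns this position and has received all its entries; entries at other
        -- positions do not enter the combination.
        by_cases hc : (f i).2 = e.2.1.1 ∧ (h s).2 = e.2.1.2
        · have : ((f i).2, (h s).2) = e.2.1 := Prod.ext hc.1 hc.2
          simp only [this, if_true]
          rw [hdec _ (hmono _ (hx _ _ _))]
        · simp only [hc, if_false]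
      · rfl)
  -- the entries of the block products are collected by the owners of their positions
  let prodEntry (x : Fin n → Inp) (e : (Fin (4 * M + 1) × Fin t) × (Fin n₁ × Fin n₁)) : F :=
    ∑ y, comb x (true, (e.2.1, y), e.1) * comb x (false, (e.2.2, y), e.1)
  have s₃ := ((s₂.deliver (E := (Fin (4 * M + 1) × Fin t) × (Fin n₁ × Fin n₁))
    hF (fun e => (work e.1).1) (fun e => (out e.2).1)
    (fun e => ((work e.1).2, (out e.2).2)) (by
      rintro ⟨w, p⟩ ⟨w', p'⟩ hE
      simp only [Prod.mk.injEq] at hE ⊢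
      obtain ⟨h1, h2, h3, h4⟩ := hE
      exact ⟨hwork (Prod.ext h1 h3), hout (Prod.ext h2 h4)⟩)
    (fun e st => ∑ y, st (true, (e.2.1, y), e.1) * st (false, (e.2.2, y), e.1))).map
      (fun v st => st.2)).congr
    (g' := fun x v e => if (out e.2).1 = v then prodEntry x e else 0) (by
      intro x hx v
      funext e
      simp [prodEntry])
  -- the entries of the distance product are decoded and sent to their addressees
  let dist (x : Fin n → Inp) (i j : Fin n) : WithTop ℤ :=
    Finset.univ.inf fun s => (x i).1 s + (x j).2 s
  have hdist : ∀ x ∈ D, ∀ i j, BoundedEntry (2 * M) (dist x i j) := fun x hx i j =>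
    BoundedEntry.inf fun s => (hx true i s).add (hx false j s)
  have s₄ := ((s₃.route (E := Bool × Fin n × Fin n) (L := 2 * L) hn (by omega)
    hF (fun e => (out ((f e.2.1).2, (f e.2.2).2)).1) (fun e => if e.1 then e.2.1 else e.2.2)
    (fun u => (card_fiber_le_of_injective _
      (fun e => (e.1, (out ((f e.2.1).2, (f e.2.2).2)).2, (f e.2.1).1, (f e.2.2).1))
      (by
        rintro ⟨σ, i, s⟩ ⟨σ', i', s'⟩ hE
        simp only [Prod.mk.injEq] at hE ⊢
        obtain ⟨h1, h2, h3, h4, h5⟩ := hE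
        have h6 := hout (Prod.ext h1 h3)
        simp only [Prod.mk.injEq] at h6
        exact ⟨h2, hf (Prod.ext h4 h6.1), hf (Prod.ext h5 h6.2)⟩) u).trans
      (by simp; nlinarith))
    (fun u => (card_fiber_le_of_injective _ (fun e => (e.1, if e.1 then e.2.2 else e.2.1))
      (by rintro ⟨σ, i, s⟩ ⟨σ', i', s'⟩ h; cases σ <;> cases σ' <;> simp at h ⊢ <;> tauto) u).trans
      (by simp; nlinarith))
    (fun e st => enc (decode fun κ => ∑ μ, lam (f e.2.1).1 (f e.2.2).1 μ *
      st ((κ, μ), ((f e.2.1).2, (f e.2.2).2))))).map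
      (fun v st => st.2)).congr
    (g' := fun x v e => if (if e.1 then e.2.1 else e.2.2) = v then
      enc (dist x e.2.1 e.2.2) else 0) (by
      intro x hx v
      funext e
      refine if_congr Iff.rfl ?_ rfl
      simp only [if_true]
      refine congrArg enc ((congrArg decode ?_).trans
        (hdecode (x e.2.1).1 (x e.2.2).2 (hx true _) (hx false _)))
      funext κ
      exact (sum_mul_eq_block hf hh halg (fun i s => expEntry M (pt κ) ((x i).1 s))
        (fun i s => expEntry M (pt κ) ((x i).2 s)) e.2.1 e.2.2).symm)
  have s₅ := s₄.map (fun v st =>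
    (fun j => dec (st (true, v, j)), fun i => dec (st (false, i, v))))
  obtain ⟨A, hA⟩ := s₅
  refine ⟨A, fun X Y hX hY v => ?_⟩
  -- Each of the two routings costs `8 * L * c`; the direct deliveries cost `2 * P * Q * c` for two
  -- factors and `P * Q * c` for one product.
  have hT : 0 + 4 * (2 * L) * c + Fintype.card (Bool × Fin P × Fin Q) * c +
      Fintype.card (Fin Q × Fin P) * c + 4 * (2 * L) * c = c * (16 * L + 3 * (P * Q)) := by
    simp
    ring
  rw [hT] at hA
  have hD : (fun u => (fun s => X u s, fun s => Y s u)) ∈ D := by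
    rintro (_ | _) i s
    · exact hY s i
    · exact hX i s
  rw [hA _ hD v]
  refine Prod.ext ?_ ?_
  · funext j
    simp only [if_true]
    exact hdec _ (hdist _ hD v j)
  · funext i
    simp only [if_true, Bool.false_eq_true, if_false]
    exact hdec _ (hdist _ hD i v)

/-! ### The exponent of rectangular matrix multiplication -/

/-- Splitting the inner dimension into `r` parts. -/
theorem HasAlgebraicAlgorithm.split {F : Type} [Field F] {n m m' r t : ℕ}
    (halg : HasAlgebraicAlgorithm F n m t) (hm : m' ≤ m * r) :
    HasAlgebraicAlgorithm F n m' (r * t) := by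
  classical
  obtain ⟨α, β, lam, halg⟩ := halg
  obtain ⟨h, hh⟩ := exists_injective_of_mul_le (J := Fin m') (by simpa using hm)
  let f : Fin n → Fin n × Fin 1 := fun i => (i, 0)
  have hf : Function.Injective f := fun i j hij => congrArg Prod.fst hij
  refine ⟨fun i s ν => if (h s).2 = (finProdFinEquiv.symm ν).1 then
      α i (h s).1 (finProdFinEquiv.symm ν).2 else 0,
    fun i s ν => if (h s).2 = (finProdFinEquiv.symm ν).1 then
      β i (h s).1 (finProdFinEquiv.symm ν).2 else 0,
    fun i j ν => lam i j (finProdFinEquiv.symm ν).2, fun A B i j => ?_⟩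
  rw [← finProdFinEquiv.sum_comp]
  simp only [Equiv.symm_apply_apply]
  rw [Fintype.sum_prod_type_right, Matrix.mul_apply,
    sum_mul_eq_block hf hh halg A (fun j s => B s j) i j]
  refine Finset.sum_congr rfl fun μ _ => ?_
  rw [Finset.mul_sum]
  refine Finset.sum_congr rfl fun y _ => ?_
  simp [blockCombination, f, mul_assoc, ite_mul]

theorem hasAlgebraicAlgorithm_one (F : Type) [Field F] (n : ℕ) :
    HasAlgebraicAlgorithm F n 1 (n * n) := by
  classical
  refine ⟨fun i _ ν => if (finProdFinEquiv.symm ν).1 = i then 1 else 0,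
    fun i _ ν => if (finProdFinEquiv.symm ν).2 = i then 1 else 0,
    fun i j ν => if finProdFinEquiv.symm ν = (i, j) then 1 else 0, fun A B i j => ?_⟩
  rw [← finProdFinEquiv.sum_comp]
  simp [Matrix.mul_apply]

/-- The rank is at least the number of entries of the product. -/
theorem HasAlgebraicAlgorithm.sq_le {F : Type} [Field F] {n m t : ℕ}
    (halg : HasAlgebraicAlgorithm F n m t) (hm : 1 ≤ m) : n * n ≤ t := by
  classical
  obtain ⟨α, β, lam, halg⟩ := halg
  let φ : (Fin t → F) →ₗ[F] (Fin n × Fin n → F) :=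
    Fintype.linearCombination F (fun μ p => lam p.1 p.2 μ)
  have hφ : Function.Surjective φ := by
    rw [← LinearMap.range_eq_top, eq_top_iff, ← (Pi.basisFun F (Fin n × Fin n)).span_eq,
      Submodule.span_le]
    rintro _ ⟨⟨i, j⟩, rfl⟩
    -- The matrix unit at `(i, j)` is itself a product, hence lies in the span of the `t`
    -- coefficient vectors.
    let A : Matrix (Fin n) (Fin m) F := fun i' s => if i' = i ∧ s = ⟨0, hm⟩ then 1 else 0
    let B : Matrix (Fin m) (Fin n) F := fun s j' => if j' = j then 1 else 0
    refine ⟨fun μ => (∑ i', ∑ j', α i' j' μ * A i' j') * (∑ i', ∑ j', β i' j' μ * B j' i'), ?_⟩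
    funext ⟨i₁, j₁⟩
    have h1 : (A * B) i₁ j₁ = if (i₁, j₁) = (i, j) then 1 else 0 := by
      rw [Matrix.mul_apply, Finset.sum_eq_single (⟨0, hm⟩ : Fin m)]
      · by_cases h1 : i₁ = i <;> by_cases h2 : j₁ = j <;> simp [A, B, h1, h2]
      · intro s _ hs
        simp [A, hs]
      · simp
    rw [halg] at h1
    simp only [φ, Fintype.linearCombination_apply, Finset.sum_apply, Pi.smul_apply, smul_eq_mul,
      Pi.basisFun_apply, Pi.single_apply]
    rw [← h1]
    exact Finset.sum_congr rfl fun μ _ => by ring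
  simpa using LinearMap.finrank_le_finrank_of_surjective hφ

theorem exists_finite_field (q : ℕ) :
    ∃ (F : Type) (_ : Field F) (_ : Finite F), q ≤ ringChar F := by
  obtain ⟨p, hqp, hp⟩ := Nat.exists_infinite_primes q
  have : Fact p.Prime := ⟨hp⟩
  exact ⟨ZMod p, inferInstance, inferInstance, by rwa [ZMod.ringChar_zmod_n]⟩

theorem one_le_ceil_rpow {n : ℕ} (hn : 1 ≤ n) (γ : ℝ) : 1 ≤ ⌈(n : ℝ) ^ γ⌉₊ :=
  Nat.one_le_ceil_iff.2 (Real.rpow_pos_of_pos (by exact_mod_cast hn) γ)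

/-- The rank is at least `n²`, so a smaller `τ` would keep a positive power of `n` bounded. This
makes the infimum defining `mmExponent` meaningful. -/
theorem IsMMExponentBound.two_le {q : ℕ} {γ τ : ℝ} (h : IsMMExponentBound q γ τ) : 2 ≤ τ := by
  by_contra! hτ
  obtain ⟨K, hK⟩ := h ((2 - τ) / 2) (by linarith)
  obtain ⟨F, _, _, hF⟩ := exists_finite_field q
  have h1 : ∀ n : ℕ, 1 ≤ n → (n : ℝ) ^ ((2 - τ) / 2) ≤ K := by
    intro n hn
    obtain ⟨t, ht, halg⟩ := hK F hF n hn
    have h2 : (n : ℝ) * n ≤ t := by exact_mod_cast halg.sq_le (one_le_ceil_rpow hn γ)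
    have hn0 : (0 : ℝ) < n := by exact_mod_cast hn
    have h3 : (n : ℝ) * n = (n : ℝ) ^ ((2 - τ) / 2) * (n : ℝ) ^ (τ + (2 - τ) / 2) := by
      rw [← Real.rpow_add hn0]
      ring_nf
      norm_num
    rw [h3] at h2
    exact le_of_mul_le_mul_right (h2.trans ht) (Real.rpow_pos_of_pos hn0 _)
  have h2 : Filter.Tendsto (fun n : ℕ => (n : ℝ) ^ ((2 - τ) / 2)) Filter.atTop Filter.atTop :=
    (tendsto_rpow_atTop (by linarith)).comp tendsto_natCast_atTop_atTop
  obtain ⟨n, hn1, hn2⟩ := ((h2.eventually_gt_atTop K).and (Filter.eventually_ge_atTop 1)).exists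
  exact absurd (h1 n hn2) (not_le.2 hn1)

theorem IsMMExponentBound.antitone {q : ℕ} {γ γ' τ : ℝ} (h : IsMMExponentBound q γ' τ)
    (hγ : γ ≤ γ') : IsMMExponentBound q γ τ := by
  intro ε hε
  obtain ⟨K, hK⟩ := h ε hε
  refine ⟨K, fun F _ _ hF n hn => ?_⟩
  obtain ⟨t, ht, halg⟩ := hK F hF n hn
  refine ⟨t, ht, ?_⟩
  have := halg.split (m' := ⌈(n : ℝ) ^ γ⌉₊) (r := 1) (by
    rw [mul_one]
    exact Nat.ceil_le_ceil (Real.rpow_le_rpow_of_exponent_le (by exact_mod_cast hn) hγ))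
  rwa [one_mul] at this

/-- Cut the inner dimension into about `n ^ (γ' - γ)` pieces and add the products. This is the
Lipschitz bound for the exponent. -/
theorem IsMMExponentBound.add {q : ℕ} {γ γ' τ : ℝ} (h : IsMMExponentBound q γ τ)
    (hγ : γ ≤ γ') : IsMMExponentBound q γ' (τ + (γ' - γ)) := by
  intro ε hε
  obtain ⟨K, hK⟩ := h ε hε
  refine ⟨2 * K, fun F _ _ hF n hn => ?_⟩
  obtain ⟨t, ht, halg⟩ := hK F hF n hn
  have hn1 : (1 : ℝ) ≤ n := by exact_mod_cast hn
  have hn0 : (0 : ℝ) < n := by linarith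
  set r := ⌈(n : ℝ) ^ (γ' - γ)⌉₊ with hr
  have hr1 : (n : ℝ) ^ (γ' - γ) ≤ r := Nat.le_ceil _
  have hr2 : (r : ℝ) ≤ 2 * (n : ℝ) ^ (γ' - γ) := by
    have h1 := Nat.ceil_lt_add_one (Real.rpow_nonneg hn0.le (γ' - γ))
    have h2 := Real.one_le_rpow hn1 (sub_nonneg.2 hγ)
    linarith
  refine ⟨r * t, ?_, halg.split ?_⟩
  · push_cast
    calc (r : ℝ) * t ≤ (2 * (n : ℝ) ^ (γ' - γ)) * (K * (n : ℝ) ^ (τ + ε)) := by gcongr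
      _ = 2 * K * ((n : ℝ) ^ (γ' - γ) * (n : ℝ) ^ (τ + ε)) := by ring
      _ = _ := by rw [← Real.rpow_add hn0]; ring_nf
  · refine Nat.ceil_le.2 ?_
    push_cast
    calc (n : ℝ) ^ γ' = (n : ℝ) ^ γ * (n : ℝ) ^ (γ' - γ) := by
          rw [← Real.rpow_add hn0]; ring_nf
      _ ≤ _ := by
          gcongr
          exact Nat.le_ceil _

theorem isMMExponentBound_zero (q : ℕ) : IsMMExponentBound q 0 2 := by
  intro ε hε
  refine ⟨1, fun F _ _ _ n hn => ⟨n * n, ?_, ?_⟩⟩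
  · have hn1 : (1 : ℝ) ≤ n := by exact_mod_cast hn
    rw [one_mul]
    calc ((n * n : ℕ) : ℝ) = (n : ℝ) ^ (2 : ℝ) := by norm_num; ring
      _ ≤ _ := Real.rpow_le_rpow_of_exponent_le hn1 (by linarith)
  · simpa using hasAlgebraicAlgorithm_one F n

theorem bddBelow_isMMExponentBound (q : ℕ) (γ : ℝ) : BddBelow {τ | IsMMExponentBound q γ τ} :=
  ⟨2, fun _ h => h.two_le⟩

theorem nonempty_isMMExponentBound (q : ℕ) (γ : ℝ) : {τ | IsMMExponentBound q γ τ}.Nonempty :=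
  ⟨_, ((isMMExponentBound_zero q).add (le_max_right γ 0)).antitone (le_max_left γ 0)⟩

theorem mmExponent_le {q : ℕ} {γ τ : ℝ} (h : IsMMExponentBound q γ τ) : mmExponent q γ ≤ τ :=
  csInf_le (bddBelow_isMMExponentBound q γ) h

theorem two_le_mmExponent (q : ℕ) (γ : ℝ) : 2 ≤ mmExponent q γ :=
  le_csInf (nonempty_isMMExponentBound q γ) fun _ h => h.two_le

/-- The infimum is attained because the definition already leaves room for `ε`; half of it absorbs
the approximation. -/
theorem isMMExponentBound_mmExponent (q : ℕ) (γ : ℝ) :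
    IsMMExponentBound q γ (mmExponent q γ) := by
  intro ε hε
  obtain ⟨τ, hτ, hlt⟩ := exists_lt_of_csInf_lt (nonempty_isMMExponentBound q γ)
    (show sInf {τ | IsMMExponentBound q γ τ} < mmExponent q γ + ε / 2 by
      change mmExponent q γ < _; linarith)
  obtain ⟨K, hK⟩ := hτ (ε / 2) (by linarith)
  refine ⟨K, fun F _ _ hF n hn => ?_⟩
  obtain ⟨t, ht, halg⟩ := hK F hF n hn
  have hn1 : (1 : ℝ) ≤ n := by exact_mod_cast hn
  refine ⟨t, ht.trans ?_, halg⟩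
  have hK0 : 0 ≤ K := by
    by_contra! hneg
    have := mul_neg_of_neg_of_pos hneg
      (Real.rpow_pos_of_pos (show (0 : ℝ) < n by linarith) (τ + ε / 2))
    have : (0 : ℝ) ≤ t := t.cast_nonneg
    linarith
  exact mul_le_mul_of_nonneg_left
    (Real.rpow_le_rpow_of_exponent_le hn1 (by linarith)) hK0

theorem mmExponent_mono (q : ℕ) : Monotone (mmExponent q) := fun _ γ' h =>
  mmExponent_le ((isMMExponentBound_mmExponent q γ').antitone h)

theorem mmExponent_lipschitz (q : ℕ) : LipschitzWith 1 (mmExponent q) := by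
  refine LipschitzWith.of_le_add fun x y => ?_
  rcases le_total x y with h | h
  · exact (mmExponent_mono q h).trans (by linarith [dist_nonneg (x := x) (y := y)])
  · rw [Real.dist_eq, abs_of_nonneg (sub_nonneg.2 h)]
    exact mmExponent_le ((isMMExponentBound_mmExponent q y).add h)

theorem mmExponent_zero (q : ℕ) : mmExponent q 0 = 2 :=
  le_antisymm (mmExponent_le (isMMExponentBound_zero q)) (two_le_mmExponent q 0)

/-! ### Solvability of the balance equation -/

theorem one_le_logb_two {m : ℕ} (hm : 2 ≤ m) : 1 ≤ Real.logb 2 m := by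
  rw [Real.le_logb_iff_rpow_le (by norm_num) (by positivity)]
  simpa using (show (2 : ℝ) ≤ m by exact_mod_cast hm)

theorem exists_isBalancedExponent (q : ℕ) {n m M : ℕ} (hM : 1 ≤ M) (hm : 2 ≤ m) (hmn : m ≤ n)
    (h : √(M * n * Real.logb 2 m) ≤ m) : ∃ γ, IsBalancedExponent q n m M γ := by
  have hn0 : (0 : ℝ) < n := by exact_mod_cast (by omega : 0 < n)
  have hm0 : (0 : ℝ) < m := by exact_mod_cast (by omega : 0 < m)
  have hM0 : (0 : ℝ) < M := by exact_mod_cast hM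
  have hlog : 0 < Real.log n := Real.log_pos (by exact_mod_cast (by omega : 1 < n))
  have h1 : (M : ℝ) * n ≤ (m : ℝ) ^ 2 := by
    have h2 := (Real.sqrt_le_left (by positivity)).1 h
    have := one_le_logb_two hm
    have h3 : (M : ℝ) * n * 1 ≤ M * n * Real.logb 2 m := by gcongr
    linarith
  have h2 : Real.log M + Real.log n ≤ 2 * Real.log m := by
    rw [← Real.log_mul hM0.ne' hn0.ne']
    have := Real.log_le_log (by positivity) h1
    rwa [Real.log_pow] at this
  set μ := Real.log M / Real.log n with hμ
  set l := Real.log m / Real.log n with hl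
  have h3 : μ + 1 ≤ 2 * l := by
    rw [hμ, hl, div_add_one hlog.ne', ← mul_div_assoc]
    gcongr
  have h4 : l ≤ 1 := (div_le_one hlog).2 (Real.log_le_log hm0 (by exact_mod_cast hmn))
  let φ : ℝ → ℝ := fun γ => (1 - μ) * γ - ((1 - μ) + (l - 1) * mmExponent q γ)
  have hφ : ContinuousOn φ (Set.Icc 0 1) := by
    have := (mmExponent_lipschitz q).continuous
    fun_prop
  -- `φ 0 = 1 + μ - 2 * l ≤ 0` follows from `M n ≤ m²`, and `φ 1 = (1 - l) * mmExponent q 1 ≥ 0`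
  -- from `m ≤ n`.
  obtain ⟨γ, hγ, h0⟩ := intermediate_value_Icc zero_le_one hφ
    (show (0 : ℝ) ∈ Set.Icc (φ 0) (φ 1) by
      constructor
      · simp only [φ, mmExponent_zero]
        linarith
      · have := two_le_mmExponent q 1
        simp only [φ]
        nlinarith)
  exact ⟨γ, hγ.1, by simp only [φ] at h0; linarith⟩

/-! ### Choice of the parameters -/

/-- Bertrand's postulate gives `p ≤ 2 * (q + 4 * n + 2)`, so `2 * q + 11` words hold a residue. The
bound `4 * n + 2 ≤ p` covers the points, the entry code and the counts up to `m`. -/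
theorem exists_prime_for_encoding (q : ℕ) {n : ℕ} (hn : 2 ≤ n) :
    ∃ p : ℕ, p.Prime ∧ q ≤ p ∧ 4 * n + 2 ≤ p ∧ p ≤ 2 ^ (Nat.clog 2 n * (2 * q + 11)) := by
  obtain ⟨p, hp, h1, h2⟩ := Nat.exists_prime_lt_and_le_two_mul (q + 4 * n + 2) (by omega)
  refine ⟨p, hp, by omega, by omega, h2.trans ?_⟩
  have hb : n ≤ 2 ^ Nat.clog 2 n := Nat.le_pow_clog (by norm_num) n
  have h3 : 2 * q + 10 ≤ (2 ^ Nat.clog 2 n) ^ (2 * q + 10) :=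
    (Nat.lt_two_pow_self (n := 2 * q + 10)).le.trans (Nat.pow_le_pow_left (hn.trans hb) _)
  calc 2 * (q + 4 * n + 2) ≤ n * (2 * q + 10) := by nlinarith
    _ ≤ 2 ^ Nat.clog 2 n * (2 ^ Nat.clog 2 n) ^ (2 * q + 10) := Nat.mul_le_mul hb h3
    _ = _ := by rw [← pow_succ', ← pow_mul]

theorem DistRoundsLE.mono {n m M : ℕ} {R R' : ℝ} (h : DistRoundsLE n m M R) (hR : R ≤ R') :
    DistRoundsLE n m M R' := by
  obtain ⟨T, hT, P⟩ := h
  exact ⟨T, hT.trans hR, P⟩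

/-- The round complexity of block multiplication with `d × e` blocks. -/
theorem distRoundsLE_of_block {q n m M d e Q : ℕ} {ρ : ℝ} (hn : 2 ≤ n) (hMn : M ≤ n)
    (hmn : m ≤ n) (hd : 1 ≤ d) (he : 1 ≤ e) (hed : e ≤ d) (hdn : d * d ≤ n)
    (halg : ∀ (F : Type) [Field F] [Finite F], q ≤ ringChar F →
      ∃ t, (4 * M + 1) * t ≤ n * Q ∧ HasAlgebraicAlgorithm F d e t)
    (hρ : 1 ≤ ρ) (h₁ : 2 * ((m : ℝ) / e + 1) ≤ d * ρ) (h₂ : 4 * (n : ℝ) ≤ d ^ 2 * ρ) :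
    DistRoundsLE n m M (2 * (2 * q + 11) * (16 + 3 * Q) * ρ) := by
  obtain ⟨p, hp, hqp, hnp, hpb⟩ := exists_prime_for_encoding q hn
  have : Fact p.Prime := ⟨hp⟩
  obtain ⟨t, ht, halg⟩ := halg (ZMod p) (by rwa [ZMod.ringChar_zmod_n])
  have hd0 : (0 : ℝ) < d := by exact_mod_cast hd
  have he0 : (0 : ℝ) < e := by exact_mod_cast he
  have hn0 : (0 : ℝ) < n := by exact_mod_cast (by omega : 0 < n)
  set P := ⌈ρ⌉₊ with hPdef
  have hP : ρ ≤ P := Nat.le_ceil _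
  have hP0 : 1 ≤ P := by exact_mod_cast hρ.trans hP
  have hP2 : (P : ℝ) ≤ 2 * ρ := by
    have := Nat.ceil_lt_add_one (show 0 ≤ ρ by linarith)
    linarith
  have hdn' : (d : ℝ) ≤ n := by exact_mod_cast (Nat.le_mul_self d).trans hdn
  have hn₁ : (⌈(n : ℝ) / d⌉₊ : ℝ) ≤ 2 * n / d := by
    have h1 := Nat.ceil_lt_add_one (show 0 ≤ (n : ℝ) / d by positivity)
    have h2 : 1 ≤ (n : ℝ) / d := (one_le_div hd0).2 hdn'
    rw [mul_div_assoc]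
    linarith
  have hm₁ : (⌈(m : ℝ) / e⌉₊ : ℝ) ≤ m / e + 1 :=
    (Nat.ceil_lt_add_one (show 0 ≤ (m : ℝ) / e by positivity)).le
  have hle : ∀ a d : ℕ, 0 < (d : ℝ) → a ≤ d * ⌈(a : ℝ) / d⌉₊ := by
    intro a d hd
    have := (div_le_iff₀ hd).1 (Nat.le_ceil ((a : ℝ) / d))
    rw [mul_comm]
    exact_mod_cast this
  have hP₁ : ⌈(n : ℝ) / d⌉₊ * ⌈(m : ℝ) / e⌉₊ ≤ n * P := by
    have : (⌈(n : ℝ) / d⌉₊ : ℝ) * ⌈(m : ℝ) / e⌉₊ ≤ n * P := by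
      calc (⌈(n : ℝ) / d⌉₊ : ℝ) * ⌈(m : ℝ) / e⌉₊ ≤ (2 * n / d) * (m / e + 1) := by gcongr
        _ = n / d * (2 * (m / e + 1)) := by ring
        _ ≤ n / d * (d * ρ) := by gcongr
        _ = n * ρ := by field_simp
        _ ≤ _ := by gcongr
    exact_mod_cast this
  have hP₂ : ⌈(n : ℝ) / d⌉₊ * ⌈(n : ℝ) / d⌉₊ ≤ n * P := by
    have : (⌈(n : ℝ) / d⌉₊ : ℝ) * ⌈(n : ℝ) / d⌉₊ ≤ n * P := by
      calc (⌈(n : ℝ) / d⌉₊ : ℝ) * ⌈(n : ℝ) / d⌉₊ ≤ (2 * n / d) * (2 * n / d) := by gcongr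
        _ = n / d ^ 2 * (4 * n) := by ring
        _ ≤ n / d ^ 2 * (d ^ 2 * ρ) := by gcongr
        _ = n * ρ := by field_simp
        _ ≤ _ := by gcongr
    exact_mod_cast this
  refine ⟨_, ?_, exists_computesDist (F := ZMod p) (L := P) (c := 2 * q + 11) (by omega)
    (by omega) hmn (by simpa [ZMod.card] using hpb) (by rw [ZMod.card]; omega) ?_ halg
    (hle n d hd0) (hle m e he0) hP₁ hP₂ ht ?_ ?_⟩
  · push_cast
    calc (2 * (q : ℝ) + 11) * (16 * P + 3 * (P * Q)) = (2 * q + 11) * (16 + 3 * Q) * P := by ring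
      _ ≤ (2 * q + 11) * (16 + 3 * Q) * (2 * ρ) := by gcongr
      _ = _ := by ring
  · intro c hc hcm h
    rw [ZMod.natCast_eq_zero_iff] at h
    have := Nat.le_of_dvd hc h
    omega
  · have : d * e ≤ n := (Nat.mul_le_mul_left d hed).trans hdn
    rw [mul_comm]
    exact Nat.mul_le_mul_right _ this
  · rw [mul_comm]
    exact Nat.mul_le_mul_right _ hdn

theorem distRoundsLE_linear {n m M : ℕ} (hn : 2 ≤ n) (hM : 1 ≤ M) (hMn : M ≤ n) (hmn : m ≤ n) :
    DistRoundsLE n m M (2728 * n) := by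
  have hn1 : (1 : ℝ) ≤ n := by exact_mod_cast (by omega : 1 ≤ n)
  have hmn' : (m : ℝ) ≤ n := by exact_mod_cast hmn
  -- One block per matrix and rank `1`: each of the at most `5 * n` evaluation points is a single
  -- block product.
  refine (distRoundsLE_of_block (q := 0) (d := 1) (e := 1) (Q := 5) (ρ := 4 * n) hn hMn hmn le_rfl
    le_rfl le_rfl (by omega) (fun F _ _ _ => ⟨1, by omega, hasAlgebraicAlgorithm_one F 1⟩)
    (by linarith) (by norm_num; linarith) (by norm_num)).mono ?_
  norm_num
  linarith

theorem distRoundsLE_of_le_sqrt {n m M : ℕ} (hM : 1 ≤ M) (hMn : M ≤ n) (hm : 2 ≤ m) (hmn : m ≤ n)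
    (h : (m : ℝ) ≤ √(M * n * Real.logb 2 m)) :
    DistRoundsLE n m M (10912 * (M * Real.logb 2 m)) := by
  have hM0 : (0 : ℝ) < M := by exact_mod_cast hM
  have hM1 : (1 : ℝ) ≤ M := by exact_mod_cast hM
  have hMn' : (M : ℝ) ≤ n := by exact_mod_cast hMn
  have hn0 : (0 : ℝ) < n := by linarith
  have hm1 : (2 : ℝ) ≤ m := by exact_mod_cast hm
  have hl := one_le_logb_two hm
  set l := Real.logb 2 m
  -- With `e = 1` the outer product has rank `d²`; this `x` is the largest side with `d² * M ≤ n`.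
  set x := √((n : ℝ) / M) with hx
  have hx2 : x ^ 2 = n / M := Real.sq_sqrt (by positivity)
  have hx1 : 1 ≤ x := Real.one_le_sqrt.2 ((one_le_div hM0).2 hMn')
  set d := ⌊x⌋₊ with hd
  have hd1 : 1 ≤ d := Nat.le_floor (by simpa using hx1)
  have hdx : (d : ℝ) ≤ x := Nat.floor_le (by linarith)
  have hxd : x ≤ 2 * d := by
    have := Nat.lt_floor_add_one x
    have : (1 : ℝ) ≤ d := by exact_mod_cast hd1
    linarith
  have hd2 : (d : ℝ) * d * M ≤ n := by
    rw [← le_div_iff₀ hM0, ← hx2, ← sq]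
    gcongr
  have hdn : d * d * M ≤ n := by exact_mod_cast hd2
  refine (distRoundsLE_of_block (q := 0) (d := d) (e := 1) (Q := 5) (ρ := 16 * (M * l)) (by omega)
    hMn hmn hd1 le_rfl hd1 (by nlinarith)
    (fun F _ _ _ => ⟨d * d, by nlinarith, hasAlgebraicAlgorithm_one F d⟩) ?_ ?_ ?_).mono ?_
  · nlinarith
  · have h1 : √(M * n * l) ≤ x * (M * l) := by
      rw [Real.sqrt_le_left (by positivity), mul_pow, hx2]
      calc (M : ℝ) * n * l ≤ M * n * l * l := le_mul_of_one_le_right (by positivity) hl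
        _ = _ := by field_simp
    have h2 : x * (M * l) ≤ 2 * d * (M * l) := by gcongr
    norm_num
    linarith
  · have h1 : (n : ℝ) ≤ (2 * d) ^ 2 * M := by
      calc (n : ℝ) = x ^ 2 * M := by rw [hx2]; field_simp
        _ ≤ _ := by gcongr
    have h2 : (2 * (d : ℝ)) ^ 2 * M ≤ (2 * d) ^ 2 * M * l :=
      le_mul_of_one_le_right (by positivity) hl
    linarith
  · norm_num
    linarith

/-- The constants in the rank bounds can be chosen uniformly for all `γ ∈ [0, 1]`. -/
theorem exists_uniform_rank_bound (q : ℕ) {ε : ℝ} (hε : 0 < ε) :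
    ∃ K : ℝ, 0 ≤ K ∧ ∀ γ : ℝ, 0 ≤ γ → γ ≤ 1 → ∃ γ' : ℝ, γ ≤ γ' ∧ γ' ≤ 1 ∧
      ∀ (F : Type) [Field F] [Finite F], q ≤ ringChar F → ∀ n : ℕ, 1 ≤ n →
        ∃ t : ℕ, (t : ℝ) ≤ K * (n : ℝ) ^ (mmExponent q γ + ε) ∧
          HasAlgebraicAlgorithm F n ⌈(n : ℝ) ^ γ'⌉₊ t := by
  -- Rounding `γ` up to the grid `j / N` raises the exponent by at most `ε / 2`, and finitely many
  -- constants remain.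
  obtain ⟨N, hN⟩ := exists_nat_gt (2 / ε)
  have hN0 : (0 : ℝ) < N := lt_trans (by positivity) hN
  choose K hK using fun j : ℕ =>
    isMMExponentBound_mmExponent q ((j : ℝ) / N) (ε / 2) (by linarith)
  refine ⟨∑ j ∈ Finset.range (N + 1), |K j|, Finset.sum_nonneg fun j _ => abs_nonneg _,
    fun γ h0 h1 => ?_⟩
  have hj1 : ⌈γ * N⌉₊ ≤ N := Nat.ceil_le.2 (mul_le_of_le_one_left hN0.le h1)
  have hj2 : γ ≤ (⌈γ * N⌉₊ : ℝ) / N := (le_div_iff₀ hN0).2 (Nat.le_ceil _)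
  have hj3 : (⌈γ * N⌉₊ : ℝ) / N ≤ γ + ε / 2 := by
    have h2 := Nat.ceil_lt_add_one (show 0 ≤ γ * N by positivity)
    have h3 : 1 ≤ ε / 2 * N := by
      rw [div_lt_iff₀ hε] at hN
      linarith
    rw [div_le_iff₀ hN0]
    linarith
  refine ⟨(⌈γ * N⌉₊ : ℝ) / N, hj2, (div_le_one hN0).2 (by exact_mod_cast hj1),
    fun F _ _ hF n hn => ?_⟩
  obtain ⟨t, ht, halg⟩ := hK ⌈γ * N⌉₊ F hF n hn
  refine ⟨t, ht.trans ?_, halg⟩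
  have hn1 : (1 : ℝ) ≤ n := by exact_mod_cast hn
  have hω : mmExponent q ((⌈γ * N⌉₊ : ℝ) / N) ≤ mmExponent q γ + ε / 2 :=
    (mmExponent_le ((isMMExponentBound_mmExponent q γ).add hj2)).trans
      (by linarith)
  have hKj : K ⌈γ * N⌉₊ ≤ ∑ j ∈ Finset.range (N + 1), |K j| :=
    (le_abs_self _).trans (Finset.single_le_sum (f := fun j => |K j|) (fun j _ => abs_nonneg _)
      (Finset.mem_range.2 (by omega)))
  calc K ⌈γ * N⌉₊ * (n : ℝ) ^ (mmExponent q ((⌈γ * N⌉₊ : ℝ) / N) + ε / 2)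
      ≤ (∑ j ∈ Finset.range (N + 1), |K j|) *
          (n : ℝ) ^ (mmExponent q ((⌈γ * N⌉₊ : ℝ) / N) + ε / 2) := by gcongr
    _ ≤ _ := mul_le_mul_of_nonneg_left (Real.rpow_le_rpow_of_exponent_le hn1 (by linarith))
      (Finset.sum_nonneg fun j _ => abs_nonneg _)

/-- The balanced exponent equates the two side lengths of the blocks. -/
theorem IsBalancedExponent.le_one_and_div_rpow_le {q n m M : ℕ} {γ : ℝ}
    (h : IsBalancedExponent q n m M γ) (hM : 1 ≤ M) (hMn : M < n) (hm : 1 ≤ m) (hmn : m ≤ n) :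
    γ ≤ 1 ∧ ∀ d : ℝ, 1 ≤ d → d ≤ ((n : ℝ) / M) ^ (1 / mmExponent q γ) →
      (m : ℝ) / d ^ γ ≤ n / d := by
  obtain ⟨-, h⟩ := h
  have hM0 : (0 : ℝ) < M := by exact_mod_cast hM
  have hm0 : (0 : ℝ) < m := by exact_mod_cast hm
  have hMn' : (M : ℝ) < n := by exact_mod_cast hMn
  have hn0 : (0 : ℝ) < n := by linarith
  have hlog : 0 < Real.log n := Real.log_pos (by exact_mod_cast (by omega : 1 < n))
  have hMlog : Real.log M < Real.log n := Real.log_lt_log hM0 hMn'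
  have hmlog : Real.log m ≤ Real.log n := Real.log_le_log hm0 (by exact_mod_cast hmn)
  have hω := two_le_mmExponent q γ
  set ω := mmExponent q γ
  -- The balance equation multiplied by `log n`. It forces `γ ≤ 1`, and says `m / D ^ γ = n / D` for
  -- `D = (n / M) ^ (1 / ω)`; for smaller `d` the inequality follows from `γ ≤ 1`.
  have h1 : (Real.log n - Real.log M) * (γ - 1) = (Real.log m - Real.log n) * ω := by
    field_simp at h
    linarith
  have hγ : γ ≤ 1 := by
    by_contra! hγ
    nlinarith [mul_pos (sub_pos.2 hMlog) (sub_pos.2 hγ)]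
  refine ⟨hγ, fun d hd hdω => ?_⟩
  have hd0 : 0 < d := by linarith
  have h2 : Real.log d ≤ 1 / ω * (Real.log n - Real.log M) := by
    have := Real.log_le_log hd0 hdω
    rwa [Real.log_rpow (by positivity), Real.log_div hn0.ne' hM0.ne'] at this
  have h3 : Real.log m - Real.log n ≤ (γ - 1) * Real.log d := by
    calc Real.log m - Real.log n = (γ - 1) * (1 / ω * (Real.log n - Real.log M)) := by
          field_simp
          linarith
      _ ≤ _ := mul_le_mul_of_nonpos_left h2 (by linarith)
  rw [div_le_div_iff₀ (by positivity) hd0, ← Real.log_le_log_iff (by positivity) (by positivity),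
    Real.log_mul hm0.ne' hd0.ne', Real.log_mul hn0.ne' (by positivity), Real.log_rpow hd0]
  linarith

theorem distRoundsLE_of_isBalancedExponent (q : ℕ) {ε : ℝ} (hε : 0 < ε) :
    ∃ C : ℝ, ∀ n m M : ℕ, 1 ≤ M → M < n → 1 ≤ m → m ≤ n → ∀ γ, IsBalancedExponent q n m M γ →
      DistRoundsLE n m M (C * ((M : ℝ) ^ (2 / (mmExponent q γ + ε)) *
        (n : ℝ) ^ (1 - 2 / (mmExponent q γ + ε)))) := by
  obtain ⟨K, hK0, hK⟩ := exists_uniform_rank_bound q hε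
  refine ⟨2 * (2 * q + 11) * (16 + 3 * ⌈5 * K⌉₊) * 16, fun n m M hM hMn hm hmn γ hγ => ?_⟩
  obtain ⟨hγ1, hblock⟩ := hγ.le_one_and_div_rpow_le hM hMn hm hmn
  obtain ⟨γ', hγγ', hγ'1, halg⟩ := hK γ hγ.1 hγ1
  have hω := two_le_mmExponent q γ
  set ω := mmExponent q γ
  have hM0 : (0 : ℝ) < M := by exact_mod_cast hM
  have hM1 : (1 : ℝ) ≤ M := by exact_mod_cast hM
  have hMn' : (M : ℝ) < n := by exact_mod_cast hMn
  have hn0 : (0 : ℝ) < n := by linarith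
  have hD1 : 1 ≤ (n : ℝ) / M := (one_le_div hM0).2 hMn'.le
  -- Chosen so that `x ^ (ω + ε) = n / M`: the rank is then `O(n / M)`, and each node gets `O(1)`
  -- block products.
  set x := ((n : ℝ) / M) ^ (1 / (ω + ε)) with hx
  have hx1 : 1 ≤ x := Real.one_le_rpow hD1 (by positivity)
  have hxpow : x ^ (ω + ε) = n / M := by
    rw [hx, ← Real.rpow_mul (by positivity), one_div_mul_cancel (by linarith), Real.rpow_one]
  have hx2 : x ^ 2 ≤ n / M := by
    rw [← hxpow, ← Real.rpow_natCast]
    exact Real.rpow_le_rpow_of_exponent_le hx1 (by push_cast; linarith)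
  have hx2n : x ^ 2 ≤ n := hx2.trans (div_le_self hn0.le hM1)
  have hbound : (n : ℝ) / x ^ 2 = (M : ℝ) ^ (2 / (ω + ε)) * (n : ℝ) ^ (1 - 2 / (ω + ε)) := by
    have : x ^ 2 = (n : ℝ) ^ (2 / (ω + ε)) / (M : ℝ) ^ (2 / (ω + ε)) := by
      rw [hx, ← Real.rpow_natCast, ← Real.rpow_mul (by positivity),
        ← Real.div_rpow hn0.le hM0.le]
      congr 1
      push_cast
      ring
    rw [this, Real.rpow_sub hn0, Real.rpow_one]
    field_simp
  rw [← hbound]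
  set d := ⌊x⌋₊ with hd
  have hd1 : 1 ≤ d := Nat.le_floor (by simpa using hx1)
  have hd1' : (1 : ℝ) ≤ d := by exact_mod_cast hd1
  have hdx : (d : ℝ) ≤ x := Nat.floor_le (by linarith)
  have hxd : x ≤ 2 * d := by
    have := Nat.lt_floor_add_one x
    linarith
  have hdd : (d : ℝ) ^ 2 ≤ n := le_trans (by gcongr) hx2n
  have hdn : d * d ≤ n := by
    rw [← sq]
    exact_mod_cast hdd
  have hdle : (d : ℝ) ≤ n := by nlinarith
  -- The factor `16` is `4` times the loss `(x / d)² ≤ 4` from rounding `x` down.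
  have h₂ : 4 * (n : ℝ) ≤ d ^ 2 * (16 * (n / x ^ 2)) := by
    rw [← mul_div_assoc, ← mul_div_assoc, le_div_iff₀ (by positivity)]
    have : x ^ 2 ≤ (2 * d) ^ 2 := by gcongr
    nlinarith
  refine (distRoundsLE_of_block (q := q) (d := d) (e := ⌈(d : ℝ) ^ γ'⌉₊) (Q := ⌈5 * K⌉₊)
    (ρ := 16 * (n / x ^ 2)) (by omega) hMn.le hmn hd1 (one_le_ceil_rpow hd1 γ') ?_ hdn ?_ ?_ ?_
    h₂).mono ?_
  · refine Nat.ceil_le.2 ?_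
    simpa using Real.rpow_le_rpow_of_exponent_le hd1' hγ'1
  · intro F _ _ hF
    obtain ⟨t, ht, hF⟩ := halg F hF d hd1
    refine ⟨t, ?_, hF⟩
    have h1 : (t : ℝ) ≤ K * (n / M) := by
      refine ht.trans (mul_le_mul_of_nonneg_left ?_ hK0)
      rw [← hxpow]
      exact Real.rpow_le_rpow (by linarith) hdx (by linarith)
    have h2 : (4 * (M : ℝ) + 1) * t ≤ n * ⌈5 * K⌉₊ := by
      calc (4 * (M : ℝ) + 1) * t ≤ (5 * M) * (K * (n / M)) := by
            gcongr
            linarith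
        _ = n * (5 * K) := by field_simp
        _ ≤ _ := by
            gcongr
            exact Nat.le_ceil _
    exact_mod_cast h2
  · have : 1 ≤ (n : ℝ) / x ^ 2 := (one_le_div (by positivity)).2 hx2n
    linarith
  · have hd0 : (0 : ℝ) < d := by linarith
    have h1 : (m : ℝ) / ⌈(d : ℝ) ^ γ'⌉₊ ≤ n / d := by
      refine le_trans ?_ (hblock d hd1' (hdx.trans ?_))
      · gcongr
        exact (Real.rpow_le_rpow_of_exponent_le hd1' hγγ').trans (Nat.le_ceil _)
      · refine Real.rpow_le_rpow_of_exponent_le hD1 ?_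
        gcongr
        linarith
    have h2 : 1 ≤ (n : ℝ) / d := (one_le_div hd0).2 hdle
    calc 2 * ((m : ℝ) / ⌈(d : ℝ) ^ γ'⌉₊ + 1) ≤ 4 * n / d := by rw [mul_div_assoc]; linarith
      _ ≤ d ^ 2 * (16 * (n / x ^ 2)) / d := by gcongr
      _ = _ := by field_simp
  · exact le_of_eq (by ring)

theorem theorem6 :
    (∃ C : ℝ, ∀ n m M : ℕ, 1 ≤ M → M ≤ n → 2 ≤ m → m ≤ n →
      ((m : ℝ) ≤ √(M * n * Real.logb 2 m) →
        DistRoundsLE n m M (C * (M * Real.logb 2 m))) ∧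
      ((n : ℝ) ^ 2 / (M * Real.logb 2 m) ≤ m →
        DistRoundsLE n m M (C * (m * M * Real.logb 2 m / n)))) ∧
    (∀ q : ℕ, ∀ ε : ℝ, 0 < ε → ∃ C : ℝ, ∀ n m M : ℕ, 1 ≤ M → M ≤ n → 2 ≤ m → m ≤ n →
      √(M * n * Real.logb 2 m) ≤ m → (m : ℝ) ≤ (n : ℝ) ^ 2 / (M * Real.logb 2 m) →
        (∃ γ : ℝ, IsBalancedExponent q n m M γ) ∧
        ∀ γ : ℝ, IsBalancedExponent q n m M γ →
          DistRoundsLE n m M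
            (C * ((M * Real.logb 2 m) ^ (2 / (mmExponent q γ + ε)) *
              (n : ℝ) ^ (1 - 2 / (mmExponent q γ + ε))))) := by
  constructor
  · refine ⟨10912, fun n m M hM hMn hm hmn => ⟨distRoundsLE_of_le_sqrt hM hMn hm hmn, fun h => ?_⟩⟩
    have hM0 : (0 : ℝ) < M := by exact_mod_cast hM
    have hn0 : (0 : ℝ) < n := by exact_mod_cast (by omega : 0 < n)
    have hl := one_le_logb_two hm
    refine (distRoundsLE_linear (by omega) hM hMn hmn).mono ?_
    have h1 : (n : ℝ) ≤ m * M * Real.logb 2 m / n := by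
      rw [div_le_iff₀ (by positivity)] at h
      rw [le_div_iff₀ hn0]
      linarith
    linarith
  · intro q ε hε
    obtain ⟨C, hC⟩ := distRoundsLE_of_isBalancedExponent q hε
    refine ⟨max C 2728, fun n m M hM hMn hm hmn h₁ _ =>
      ⟨exists_isBalancedExponent q hM hm hmn h₁, fun γ hγ => ?_⟩⟩
    have hM0 : (0 : ℝ) < M := by exact_mod_cast hM
    have hn0 : (0 : ℝ) < n := by exact_mod_cast (by omega : 0 < n)
    have hω := two_le_mmExponent q γ
    have hMl : (M : ℝ) ≤ M * Real.logb 2 m :=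
      le_mul_of_one_le_right hM0.le (one_le_logb_two hm)
    have hexp : 0 ≤ 2 / (mmExponent q γ + ε) := by positivity
    have hle : (M : ℝ) ^ (2 / (mmExponent q γ + ε)) * (n : ℝ) ^ (1 - 2 / (mmExponent q γ + ε)) ≤
        (M * Real.logb 2 m) ^ (2 / (mmExponent q γ + ε)) *
          (n : ℝ) ^ (1 - 2 / (mmExponent q γ + ε)) := by gcongr
    have hmax : (0 : ℝ) ≤ max C 2728 := le_max_of_le_right (by norm_num)
    -- For `M = n` the coefficient of `γ` in the balance equation vanishes and gives no control of
    -- `γ`, but the claimed bound is at least of order `n`. Otherwise the bound holds without the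
    -- factor `log m`, which only weakens it.
    rcases hMn.lt_or_eq with hlt | rfl
    · exact (hC n m M hM hlt (by omega) hmn γ hγ).mono
        (mul_le_mul (le_max_left _ _) hle (by positivity) hmax)
    · rw [← Real.rpow_add hM0, add_sub_cancel, Real.rpow_one] at hle
      exact (distRoundsLE_linear (by omega) hM le_rfl hmn).mono
        (mul_le_mul (le_max_right _ _) hle hM0.le hmax)
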